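/- **The round-corner lemma.** Consider the plane $\{x_2=0\}\subset\mathbb{R}^3$ with coordinates $(x_3,x_1)$ ($x_3$ the abscissa, $x_1$ the ordinate). For a regular curve $r$ in this plane let $T=r'/\|r'\|$ be its unit tangent and let $n$ be its unit normal obtained by turning $T=(T_{x_3},T_{x_1})$ clockwise by a right angle, $n=(T_{x_1},-T_{x_3})$. If $r$ lies in $\{x_1>0\}$, rotate $r$ together with $n$ about the $x_3$-axis, and let $H(s)$ be the mean curvature (half the sum of the principal curvatures) at $r(s)$ of the resulting surface of revolution with respect to the rotated normal. Let $I_1,I_2\subset\mathbb{R}$ be intervals with $0\in I_1\cap I_2$ such that $I_1$ contains a negative number and $I_2$ contains a positive number. For $i=1,2$ let $r_i:I_i\to\{x_1>0\}$ be a smooth curve parametrized by arc length (smooth at an end point of $I_i$ that belongs to $I_i$ means that $r_i$ extends smoothly beyond it) that is embedded, i.e. injective and a homeomorphism onto its image. Suppose that $r_1(0)=r_2(0)=p$, that $p$ is the only common point of $r_1(I_1)$ and $r_2(I_2)$, and that the curves are transversal at $p$. Let $T_i,n_i,H_i$ be the tangent, the normal and the mean curvature function of $r_i$, and put $J=(I_1\cap(-\infty,0])\cup(I_2\cap[0,\infty))$.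 (a) Suppose that $T_2(0)\cdot n_1(0)>0$, that is, $r_1$ turns right into $r_2$ at $p$. Then for every $\delta>0$ there exist arbitrarily small $\varepsilon>0$ with $-\varepsilon\in I_1$, $\varepsilon\in I_2$, for which there is a smooth regular curve $r:J\to\{x_1>0\}$ (not necessarily parametrized by arc length) such that 1. $r(s)=r_1(s)$ for $s\le-\varepsilon$ and $r(s)=r_2(s)$ for $s\ge\varepsilon$; 2. $\|r(s)-p\|<\delta$ for $|s|\le\varepsilon$, and $r$ has no self-intersection, i.e. it is injective on $J$; moreover $r$ is a homeomorphism onto its image whenever the curve with a corner that is $r_1$ on $J\cap(-\infty,0]$ and $r_2$ on $J\cap(0,\infty)$ is one; 3. the mean curvature function $H$ of $r$ satisfies $H(s)\ge H_1(s)$ for $-\varepsilon<s<0$ and $H(s)\ge H_2(s)$ for $0<s<\varepsilon$. (b) If instead $T_2(0)\cdot n_1(0)<0$, the same holds with the inequalities in 3 replaced by $H(s)\le H_1(s)$ for $-\varepsilon<s<0$ and $H(s)\le H_2(s)$ for $0<s<\varepsilon$. -/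

import Mathlib

open scoped ContDiff

namespace RoundCorner

noncomputable section

/-- The half-plane of profile curves lies in the plane `x₂ = 0` of `ℝ³`. A point of this plane is
written as `(x₃, x₁)`: index `0` is the `x₃`-coordinate (abscissa, the axis of rotation) and
index `1` is the `x₁`-coordinate (ordinate, the signed distance to the axis of rotation). -/
abbrev Plane : Type := EuclideanSpace ℝ (Fin 2)

/-- Euclidean 3-space with coordinates `(x₁, x₂, x₃)`. -/
abbrev Space : Type := EuclideanSpace ℝ (Fin 3)

/-- The unit tangent vector `T = r' / ‖r'‖` of a plane curve. -/
def unitTangent (r : ℝ → Plane) (s : ℝ) : Plane :=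
  ‖deriv r s‖⁻¹ • deriv r s

/-- The unit normal of a plane curve: in the coordinates `(x₃, x₁)` it is `T` turned
clockwise by a right angle (equivalently, turned counterclockwise when the coordinates are read
in the order `(x₁, x₃)`). For a circle about the origin that is run through clockwise this is
the inward normal. -/
def unitNormal (r : ℝ → Plane) (s : ℝ) : Plane :=
  !₂[unitTangent r s 1, -unitTangent r s 0]

/-- The rotation about the `x₃`-axis by the angle `φ`, applied to the point (or the vector) of
the plane `x₂ = 0` with coordinates `(x₃, x₁) = (q 0, q 1)`. -/
def rotate (q : Plane) (φ : ℝ) : Space :=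
  !₂[q 1 * Real.cos φ, q 1 * Real.sin φ, q 0]

/-- The mean curvature, at the parameter `(u, v)`, of the parametrized surface `X` in `ℝ³` with
the unit normal field `N`: half the trace of the second fundamental form with respect to the
first one. -/
def meanCurvature (X N : ℝ → ℝ → Space) (u v : ℝ) : ℝ :=
  let Xu : Space := deriv (fun a => X a v) u
  let Xv : Space := deriv (fun b => X u b) v
  let Xuu : Space := deriv (fun a => deriv (fun a' => X a' v) a) u
  let Xuv : Space := deriv (fun b => deriv (fun a => X a b) u) v
  let Xvv : Space := deriv (fun b => deriv (fun b' => X u b') b) v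
  let E : ℝ := inner ℝ Xu Xu
  let F : ℝ := inner ℝ Xu Xv
  let G : ℝ := inner ℝ Xv Xv
  let L : ℝ := inner ℝ Xuu (N u v)
  let M : ℝ := inner ℝ Xuv (N u v)
  let P : ℝ := inner ℝ Xvv (N u v)
  (L * G - 2 * M * F + P * E) / (2 * (E * G - F ^ 2))

/-- The mean curvature at the point `r s` (rotation angle `0`) of the surface obtained by rotating
the curve `r` about the `x₃`-axis, with respect to the rotated unit normal of `r`. -/
def revolutionMeanCurvature (r : ℝ → Plane) (s : ℝ) : ℝ :=
  meanCurvature (fun u φ => rotate (r u) φ) (fun u φ => rotate (unitNormal r u) φ) s 0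

/-- `r`, restricted to the interval `I`, is a smooth embedded curve in the open half-plane
`x₁ > 0`, parametrized by arc length. Smoothness at an end point of `I` that belongs to `I` is
that of an extension of the curve beyond this end point. -/
structure IsEmbeddedArcLengthCurve (r : ℝ → Plane) (I : Set ℝ) : Prop where
  ordConnected : I.OrdConnected
  smooth : ∀ s ∈ I, ContDiffAt ℝ ∞ r s
  arcLength : ∀ s ∈ I, ‖deriv r s‖ = 1
  embedding : Topology.IsEmbedding (I.domRestrict r)
  halfPlane : ∀ s ∈ I, 0 < r s 1

/-- The parameter interval of the curve that runs along the first curve up to the parameter `0`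
and then along the second one. -/
def cornerDomain (I₁ I₂ : Set ℝ) : Set ℝ :=
  (I₁ ∩ Set.Iic 0) ∪ (I₂ ∩ Set.Ici 0)

/-- The curve with a corner that runs along `r₁` up to the parameter `0` and then along `r₂`. -/
def cornerCurve (r₁ r₂ : ℝ → Plane) (s : ℝ) : Plane :=
  if s ≤ 0 then r₁ s else r₂ s

/-- `r` is a round corner that joins `r₁` (before `-ε`) to `r₂` (after `ε`) inside the ball of
radius `δ` about `p`. -/
structure IsRoundCorner (r₁ r₂ : ℝ → Plane) (I₁ I₂ : Set ℝ) (p : Plane) (δ ε : ℝ)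
    (r : ℝ → Plane) : Prop where
  left_mem : -ε ∈ I₁
  right_mem : ε ∈ I₂
  smooth : ∀ s ∈ cornerDomain I₁ I₂, ContDiffAt ℝ ∞ r s
  regular : ∀ s ∈ cornerDomain I₁ I₂, deriv r s ≠ 0
  halfPlane : ∀ s ∈ cornerDomain I₁ I₂, 0 < r s 1
  eq_left : ∀ s ≤ -ε, r s = r₁ s
  eq_right : ∀ s, ε ≤ s → r s = r₂ s
  near : ∀ s ∈ Set.Icc (-ε) ε, dist (r s) p < δ
  injective : Set.InjOn r (cornerDomain I₁ I₂)
  /-- Unless one of the given curves accumulates at the other one, which `r` cannot repair,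
  `r` is also a homeomorphism onto its image. -/
  embedding : Topology.IsEmbedding ((cornerDomain I₁ I₂).domRestrict (cornerCurve r₁ r₂)) →
    Topology.IsEmbedding ((cornerDomain I₁ I₂).domRestrict r)

end

end RoundCorner

namespace RoundCorner

/-! Write `T₁`, `T₂` for the tangents at the corner and `D = T₂ - T₁`. The corner formed by the two
tangent lines is smoothed at scale `ε` by adding `ε φ(s/ε) D` to the first line, where `φ` is a
smooth convex positive part with `φ' = P` and `φ'' = ρ`. The deviations of the curves from their
tangents are added back, cut off near `0` by `χ`, so that the two sides match smoothly
(`roundedCurve`). Since `φ t - φ (-t) = t`, each side is a bending (`bentCurve`) of its own curve.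

The bending adds `(ρ/ε) D` to the acceleration, hence a curvature gain of order `ρ/ε` with the sign
of the turn. It also changes position and velocity by at most a multiple of `ρ`, because `φ ≤ P ≤ ρ`
on `[-1, 0]`. The cut-off errors are bounded and vanish unless `t ≥ -1/2`, where `ρ` has a positive
lower bound, so they too are `O(ρ)`. Without the large term, twice the mean curvature is a Lipschitz
function of position, velocity and acceleration on the relevant compact set. The total loss is
therefore `O(ρ)`, and the gain wins for small `ε`, even where `ρ` tends to `0` (`bentCurve_spec`).

The vector `e = T₁ + T₂` is orthogonal to `D`, so bending does not affect the velocity along `e`,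
which stays positive: the new curve is regular and injective near the corner. Embeddedness of the
given curves keeps their remote parts away from `p`. -/

/-! ### Auxiliary functions: smooth positive part and cut-off -/

/-- A smooth convex approximation of the positive part, whose second derivative dominates its
first derivative and its value on the left of `0`. -/
structure IsSmoothPosPart (φ P ρ : ℝ → ℝ) : Prop where
  contDiff : ContDiff ℝ ∞ φ
  hasDerivAt : ∀ t, HasDerivAt φ (P t) t
  hasDerivAt' : ∀ t, HasDerivAt P (ρ t) t
  eq_zero : ∀ t ≤ -1, φ t = 0
  sub_neg : ∀ t, φ t - φ (-t) = t
  deriv_mem : ∀ t, P t ∈ Set.Icc 0 1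
  deriv_le : ∀ t ∈ Set.Icc (-1 : ℝ) 0, P t ≤ ρ t
  nonneg : ∀ t, 0 ≤ φ t
  le : ∀ t ∈ Set.Icc (-1 : ℝ) 0, φ t ≤ P t
  second_nonneg : ∀ t, 0 ≤ ρ t
  second_pos : ∃ m > 0, ∀ t ∈ Set.Icc (-1/2 : ℝ) 0, m ≤ ρ t

/-- Integrate a normalized even bump on `[-1, 1]` twice. Evenness gives `P t + P (-t) = 1`, which
integrates to `φ t - φ (-t) = t`. -/
theorem exists_smoothPosPart : ∃ φ P ρ : ℝ → ℝ, IsSmoothPosPart φ P ρ := by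
  set ρ₁ : ℝ → ℝ := fun t => expNegInvGlue (1 - t ^ 2) with hρ₁
  have hsm : ContDiff ℝ ∞ ρ₁ := expNegInvGlue.contDiff.comp (by fun_prop)
  have hnn : ∀ t, 0 ≤ ρ₁ t := fun t => expNegInvGlue.nonneg _
  have hmono₁ : ∀ s t : ℝ, s ≤ t → t ≤ 0 → ρ₁ s ≤ ρ₁ t := fun s t hst ht =>
    expNegInvGlue.monotone (by nlinarith)
  have hzero : ∀ t ≤ -1, ρ₁ t = 0 := fun t ht =>
    expNegInvGlue.zero_of_nonpos (by nlinarith)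
  set c : ℝ := ∫ t in (-1 : ℝ)..1, ρ₁ t with hc
  have hcpos : 0 < c := by
    refine intervalIntegral.intervalIntegral_pos_of_pos_on
      (hsm.continuous.intervalIntegrable _ _) (fun t ht => ?_) (by norm_num)
    exact expNegInvGlue.pos_of_pos (by nlinarith [ht.1, ht.2])
  set ρ : ℝ → ℝ := fun t => ρ₁ t / c with hρ
  have hρsm : ContDiff ℝ ∞ ρ := hsm.div_const c
  have hρnn : ∀ t, 0 ≤ ρ t := fun t => div_nonneg (hnn t) hcpos.le
  have hρmono : ∀ s t : ℝ, s ≤ t → t ≤ 0 → ρ s ≤ ρ t := fun s t hst ht =>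
    div_le_div_of_nonneg_right (hmono₁ s t hst ht) hcpos.le
  have hρeven : ∀ t, ρ (-t) = ρ t := fun t => by simp [hρ, hρ₁]
  have hρzero : ∀ t ≤ -1, ρ t = 0 := fun t ht => by simp [hρ, hzero t ht]
  set P : ℝ → ℝ := fun t => ∫ u in (-1 : ℝ)..t, ρ u with hP
  have hPd : ∀ t, HasDerivAt P (ρ t) t := fun t =>
    intervalIntegral.integral_hasDerivAt_right (hρsm.continuous.intervalIntegrable _ _)
      (hρsm.continuous.stronglyMeasurableAtFilter _ _) hρsm.continuous.continuousAt
  have hPsm : ContDiff ℝ ∞ P := by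
    rw [contDiff_infty_iff_deriv]
    exact ⟨fun t => (hPd t).differentiableAt, by
      rw [show deriv P = ρ from funext fun t => (hPd t).deriv]; exact hρsm⟩
  set φ : ℝ → ℝ := fun t => ∫ u in (-1 : ℝ)..t, P u with hφ
  have hφd : ∀ t, HasDerivAt φ (P t) t := fun t =>
    intervalIntegral.integral_hasDerivAt_right (hPsm.continuous.intervalIntegrable _ _)
      (hPsm.continuous.stronglyMeasurableAtFilter _ _) hPsm.continuous.continuousAt
  have hφsm : ContDiff ℝ ∞ φ := by
    rw [contDiff_infty_iff_deriv]
    exact ⟨fun t => (hφd t).differentiableAt, by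
      rw [show deriv φ = P from funext fun t => (hφd t).deriv]; exact hPsm⟩
  have hPzero : ∀ t ≤ -1, P t = 0 := fun t ht => by
    refine intervalIntegral.integral_zero_ae (Filter.Eventually.of_forall fun u hu => ?_)
    rw [Set.uIoc_of_ge ht] at hu
    exact hρzero u hu.2
  have hφzero : ∀ t ≤ -1, φ t = 0 := fun t ht => by
    refine intervalIntegral.integral_zero_ae (Filter.Eventually.of_forall fun u hu => ?_)
    rw [Set.uIoc_of_ge ht] at hu
    exact hPzero u hu.2
  have hPmono : Monotone P := monotone_of_hasDerivAt_nonneg hPd hρnn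
  have hPone : P 1 = 1 := by
    simp only [hP, hρ, intervalIntegral.integral_div]
    exact div_self hcpos.ne'
  have hPsymm : ∀ t, P t + P (-t) = 1 := by
    have hd : ∀ t, HasDerivAt (fun t => P t + P (-t)) 0 t := fun t => by
      have := (hPd t).add ((hPd (-t)).comp t (hasDerivAt_neg t))
      rw [hρeven] at this
      have h2 : ρ t + ρ t * -1 = 0 := by ring
      rw [h2] at this
      exact this
    intro t
    have := is_const_of_deriv_eq_zero (fun t => (hd t).differentiableAt)
      (fun t => (hd t).deriv) t 1
    simp only [this, hPone, hPzero (-1) le_rfl, add_zero]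
  have hPnn : ∀ t, 0 ≤ P t := fun t => by
    rw [← hPzero (min t (-1)) (min_le_right _ _)]
    exact hPmono (min_le_left _ _)
  have hφmono : Monotone φ := monotone_of_hasDerivAt_nonneg hφd hPnn
  -- The interval `[-1, t]` has length at most `1` and `f` is largest at its right end. Applied to
  -- `ρ` and to `P`, this yields `P ≤ ρ` and `φ ≤ P`.
  have hbound : ∀ f : ℝ → ℝ, Continuous f → (∀ t, 0 ≤ f t) →
      (∀ s t : ℝ, s ≤ t → t ≤ 0 → f s ≤ f t) → ∀ t ∈ Set.Icc (-1 : ℝ) 0,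
      ∫ u in (-1 : ℝ)..t, f u ≤ f t := by
    intro f hf h0 hm t ht
    calc ∫ u in (-1 : ℝ)..t, f u ≤ ∫ _ in (-1 : ℝ)..t, f t :=
          intervalIntegral.integral_mono_on ht.1 (hf.intervalIntegrable _ _) (by simp)
            fun u hu => hm u t hu.2 ht.2
      _ = (t + 1) * f t := by simp
      _ ≤ f t := by nlinarith [h0 t, ht.2]
  refine ⟨φ, P, ρ, hφsm, hφd, hPd, hφzero, ?_, ?_, ?_, ?_, ?_, hρnn, ?_⟩
  · have hd : ∀ t, HasDerivAt (fun t => φ t - φ (-t) - t) 0 t := fun t => by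
      have := ((hφd t).sub ((hφd (-t)).comp t (hasDerivAt_neg t))).sub (hasDerivAt_id t)
      have h1 := hPsymm t
      have h2 : P t - P (-t) * -1 - 1 = 0 := by linarith
      rw [h2] at this
      exact this
    intro t
    have := is_const_of_deriv_eq_zero (fun t => (hd t).differentiableAt)
      (fun t => (hd t).deriv) t 0
    simp only [neg_zero, sub_self] at this
    linarith
  · exact fun t => ⟨hPnn t, by linarith [hPsymm t, hPnn (-t)]⟩
  · exact hbound ρ hρsm.continuous hρnn hρmono
  · intro t
    rw [← hφzero (min t (-1)) (min_le_right _ _)]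
    exact hφmono (min_le_left _ _)
  · exact hbound P hPsm.continuous hPnn fun s t hst _ => hPmono hst
  · refine ⟨ρ (-1/2), div_pos (expNegInvGlue.pos_of_pos (by norm_num)) hcpos, fun t ht => ?_⟩
    exact hρmono _ _ ht.1 ht.2

/-- A smooth cut-off function together with a bound for the first derivatives of `χ - 1`. -/
theorem exists_cutoff : ∃ χ : ℝ → ℝ, ContDiff ℝ ∞ χ ∧ (∀ t ≤ -1/2, χ t = 1) ∧
    (∀ t, -1/4 ≤ t → χ t = 0) ∧ ∃ G : ℝ, 0 ≤ G ∧ ∀ t ∈ Set.Icc (-1 : ℝ) 0,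
      |χ t - 1| ≤ G ∧ |deriv χ t| ≤ G ∧ |deriv (deriv χ) t| ≤ G := by
  set χ : ℝ → ℝ := fun t => 1 - Real.smoothTransition (4 * t + 2) with hχ
  have hsm : ContDiff ℝ ∞ χ :=
    contDiff_const.sub (Real.smoothTransition.contDiff.comp (by fun_prop))
  have h1 := (contDiff_infty_iff_deriv.1 hsm).2
  have h2 := (contDiff_infty_iff_deriv.1 h1).2
  refine ⟨χ, hsm, fun t ht => ?_, fun t ht => ?_, ?_⟩
  · simp [hχ, Real.smoothTransition.zero_of_nonpos (show 4 * t + 2 ≤ 0 by linarith)]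
  · simp [hχ, Real.smoothTransition.one_of_one_le (show 1 ≤ 4 * t + 2 by linarith)]
  · have hc : Continuous fun t => |χ t - 1| + |deriv χ t| + |deriv (deriv χ) t| :=
      (((hsm.continuous.sub continuous_const).abs.add h1.continuous.abs).add h2.continuous.abs)
    obtain ⟨G, hG⟩ := (isCompact_Icc (a := (-1 : ℝ)) (b := 0)).bddAbove_image hc.continuousOn
    have hG' : ∀ t ∈ Set.Icc (-1 : ℝ) 0,
        |χ t - 1| + |deriv χ t| + |deriv (deriv χ) t| ≤ G := fun t ht =>
      hG (Set.mem_image_of_mem _ ht)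
    have ha := fun t => abs_nonneg (χ t - 1)
    have hb := fun t => abs_nonneg (deriv χ t)
    have hd := fun t => abs_nonneg (deriv (deriv χ) t)
    refine ⟨G, ?_, fun t ht => ⟨?_, ?_, ?_⟩⟩
    · linarith [hG' 0 (by norm_num), ha 0, hb 0, hd 0]
    all_goals linarith [hG' t ht, ha t, hb t, hd t]

/-! ### Mean curvature in terms of the profile curve -/

/-- The oriented area `a₀ b₁ - a₁ b₀` of two plane vectors. -/
def cross (a b : Plane) : ℝ := a 0 * b 1 - a 1 * b 0

/-- Twice the mean curvature of a surface of revolution in terms of the position, the velocity and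
the acceleration of its profile curve. -/
noncomputable def curvatureSum (a v w : Plane) : ℝ :=
  cross w v / ‖v‖ ^ 3 + v 0 / (‖v‖ * a 1)

/-- `rotate` as a continuous linear map of the rotated vector. -/
noncomputable def rotateCLM (φ : ℝ) : Plane →L[ℝ] Space :=
  LinearMap.toContinuousLinearMap
    { toFun := fun q => rotate q φ
      map_add' := fun q q' => by ext i; fin_cases i <;> simp [rotate] <;> ring
      map_smul' := fun c q => by ext i; fin_cases i <;> simp [rotate] <;> ring }

theorem hasDerivAt_euclidean {n : ℕ} {f : ℝ → EuclideanSpace ℝ (Fin n)}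
    {f' : EuclideanSpace ℝ (Fin n)} {x : ℝ} :
    HasDerivAt f f' x ↔ ∀ i, HasDerivAt (fun u => f u i) (f' i) x := by
  simp only [hasDerivAt_iff_hasFDerivAt]
  rw [← hasFDerivWithinAt_univ, hasFDerivWithinAt_euclidean]
  refine forall_congr' fun i => ?_
  rw [hasFDerivWithinAt_univ]
  refine iff_of_eq ?_
  congr 1

theorem deriv_rotate_comp {r : ℝ → Plane} {s : ℝ} (hr : DifferentiableAt ℝ r s) (φ : ℝ) :
    deriv (fun a => rotate (r a) φ) s = rotate (deriv r s) φ :=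
  ((rotateCLM φ).hasFDerivAt.comp_hasDerivAt s hr.hasDerivAt).deriv

theorem hasDerivAt_rotate (q : Plane) (φ : ℝ) :
    HasDerivAt (fun b => rotate q b)
      (!₂[-(q 1 * Real.sin φ), q 1 * Real.cos φ, 0] : Space) φ := by
  rw [hasDerivAt_euclidean]
  intro i
  fin_cases i
  · simpa [rotate] using (Real.hasDerivAt_cos φ).const_mul (q 1)
  · simpa [rotate] using (Real.hasDerivAt_sin φ).const_mul (q 1)
  · simpa [rotate] using hasDerivAt_const φ (q 0)

theorem deriv_deriv_rotate (q : Plane) (φ : ℝ) :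
    deriv (fun b => deriv (fun b' => rotate q b') b) φ =
      (!₂[-(q 1 * Real.cos φ), -(q 1 * Real.sin φ), 0] : Space) := by
  simp_rw [fun b => (hasDerivAt_rotate q b).deriv]
  refine HasDerivAt.deriv ?_
  rw [hasDerivAt_euclidean]
  intro i
  fin_cases i
  · have h := ((Real.hasDerivAt_sin φ).const_mul (q 1)).neg
    simpa using! h
  · simpa using (Real.hasDerivAt_cos φ).const_mul (q 1)
  · simpa using hasDerivAt_const φ (0 : ℝ)

/-- Meridians and parallels are orthogonal and `M = F = 0`, so only the two principal terms remain.
-/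
theorem revolutionMeanCurvature_eq {r : ℝ → Plane} {s : ℝ} (hr : ContDiffAt ℝ 2 r s)
    (hy : 0 < r s 1) (hv : deriv r s ≠ 0) :
    revolutionMeanCurvature r s =
      curvatureSum (r s) (deriv r s) (deriv (deriv r) s) / 2 := by
  have hev : ∀ᶠ u in nhds s, DifferentiableAt ℝ r u :=
    (hr.eventually (by simp)).mono fun u hu => hu.differentiableAt (by simp)
  have hd : DifferentiableAt ℝ r s := hev.self_of_nhds
  have hd2 : DifferentiableAt ℝ (deriv r) s := by
    exact (hr.derivWithin (m := 1) (by norm_num)).differentiableAt (by simp)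
  have h1 : deriv (fun a => rotate (r a) 0) s = rotate (deriv r s) 0 := deriv_rotate_comp hd 0
  have h2 : deriv (fun a => deriv (fun a' => rotate (r a') 0) a) s =
      rotate (deriv (deriv r) s) 0 := by
    rw [← deriv_rotate_comp hd2 0]
    exact Filter.EventuallyEq.deriv_eq (hev.mono fun u hu => deriv_rotate_comp hu 0)
  have h3 : deriv (fun b => deriv (fun a => rotate (r a) b) s) 0 =
      (!₂[0, deriv r s 1, 0] : Space) := by
    simp_rw [deriv_rotate_comp hd]
    rw [(hasDerivAt_rotate _ _).deriv]
    simp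
  have hn : 0 < ‖deriv r s‖ := norm_pos_iff.2 hv
  have hn2 : ‖deriv r s‖ ^ 2 = deriv r s 0 ^ 2 + deriv r s 1 ^ 2 := by
    simp [EuclideanSpace.norm_sq_eq]
  have h4 := deriv_deriv_rotate (r s) 0
  unfold revolutionMeanCurvature meanCurvature
  simp only [h1, h2, h3, h4]
  simp only [(hasDerivAt_rotate _ _).deriv]
  simp only [PiLp.inner_apply, rotate, Fin.sum_univ_three, unitNormal, unitTangent,
    curvatureSum, cross]
  simp
  set x' := deriv r s 0
  set y' := deriv r s 1
  set n := ‖deriv r s‖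
  rw [show y' ^ 2 + x' ^ 2 = n ^ 2 by rw [hn2]; ring]
  field_simp
  ring

/-- Isolates the acceleration term of size `1/ε`, so that the Lipschitz bound is needed only for
bounded accelerations. -/
theorem curvatureSum_add_smul (a v w D : Plane) (q : ℝ) :
    curvatureSum a v (w + q • D) = curvatureSum a v w + q * (cross D v / ‖v‖ ^ 3) := by
  simp only [curvatureSum, cross, PiLp.add_apply, PiLp.smul_apply, smul_eq_mul]
  ring

/-- The expression is `C¹` away from zero velocity and from the axis. The condition `κ ≤ inner ℝ e
v` and the ball of radius `p 1 / 2` stay away from both and leave a compact set, on which locally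
Lipschitz implies Lipschitz. -/
theorem curvatureSum_lipschitz (p e : Plane) (hp : 0 < p 1) {κ : ℝ} (hκ : 0 < κ) (M : ℝ) :
    ∃ L : ℝ, 0 ≤ L ∧ ∀ a v w a' v' w' : Plane, ‖a - p‖ ≤ p 1 / 2 → ‖a' - p‖ ≤ p 1 / 2 →
      κ ≤ inner ℝ e v → κ ≤ inner ℝ e v' → ‖v‖ ≤ M → ‖v'‖ ≤ M → ‖w‖ ≤ M → ‖w'‖ ≤ M →
      |curvatureSum a v w - curvatureSum a' v' w'| ≤ L * (‖a - a'‖ + ‖v - v'‖ + ‖w - w'‖) := by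
  set S : Set (Plane × Plane × Plane) :=
    Metric.closedBall p (p 1 / 2) ×ˢ
      ((Metric.closedBall 0 M ∩ {v | κ ≤ inner ℝ e v}) ×ˢ Metric.closedBall 0 M)
  have hS : IsCompact S := by
    refine (isCompact_closedBall _ _).prod (IsCompact.prod ?_ (isCompact_closedBall _ _))
    exact (isCompact_closedBall _ _).inter_right
      (isClosed_le continuous_const (continuous_const.inner continuous_id))
  have hpos : ∀ a : Plane, ‖a - p‖ ≤ p 1 / 2 → 0 < a 1 := by
    intro a ha
    have h := (PiLp.norm_apply_le (a - p) 1).trans ha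
    rw [PiLp.sub_apply, Real.norm_eq_abs, abs_le] at h
    linarith [h.1]
  set F : Plane × Plane × Plane → ℝ := fun x => curvatureSum x.1 x.2.1 x.2.2
  have hF : LocallyLipschitzOn S F := by
    rintro ⟨a, v, w⟩ ⟨ha, ⟨hv, hv'⟩, hw⟩
    have ha' : a 1 ≠ 0 := (hpos a (by simpa [dist_eq_norm] using ha)).ne'
    have hv0 : v ≠ 0 := by
      rintro rfl
      simp at hv'
      linarith
    have hn : ‖v‖ ≠ 0 := norm_ne_zero_iff.2 hv0
    have hc : ContDiffAt ℝ 1 F (a, v, w) := by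
      have hvn : ContDiffAt ℝ 1 (fun x : Plane × Plane × Plane => ‖x.2.1‖) (a, v, w) :=
        ContDiffAt.norm ℝ (by fun_prop) hv0
      simp only [F, curvatureSum, cross]
      refine ContDiffAt.add (ContDiffAt.div (by fun_prop) (hvn.pow 3) (pow_ne_zero 3 hn))
        (ContDiffAt.div (by fun_prop) (hvn.mul (by fun_prop)) (mul_ne_zero hn ha'))
    obtain ⟨K, t, ht, hK⟩ := hc.exists_lipschitzOnWith
    exact ⟨K, t, nhdsWithin_le_nhds ht, hK⟩
  obtain ⟨K, hK⟩ := hF.exists_lipschitzOnWith_of_compact hS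
  refine ⟨K, K.2, fun a v w a' v' w' ha ha' hv hv' hvM hvM' hwM hwM' => ?_⟩
  have h := hK.dist_le_mul (a, v, w) ⟨by simpa [dist_eq_norm] using ha,
    ⟨by simpa using hvM, hv⟩, by simpa using hwM⟩ (a', v', w')
    ⟨by simpa [dist_eq_norm] using ha', ⟨by simpa using hvM', hv'⟩, by simpa using hwM'⟩
  rw [Real.dist_eq] at h
  refine h.trans (mul_le_mul_of_nonneg_left ?_ K.2)
  simp only [Prod.dist_eq]
  simp only [dist_eq_norm]
  have h1 := norm_nonneg (a - a')
  have h2 := norm_nonneg (v - v')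
  have h3 := norm_nonneg (w - w')
  exact max_le (by linarith) (max_le (by linarith) (by linarith))

/-! ### Bending one curve at scale `ε` -/

theorem exists_taylor_bound {b : ℝ → Plane} (hb : ContDiffAt ℝ 2 b 0) :
    ∃ a > 0, ∃ M : ℝ, 0 ≤ M ∧ ∀ s, |s| < a → ContDiffAt ℝ 2 b s ∧ ‖deriv (deriv b) s‖ ≤ M ∧
      ‖deriv b s - deriv b 0‖ ≤ M * |s| ∧ ‖b s - b 0 - s • deriv b 0‖ ≤ M * |s| * |s| := by
  have hc : ContinuousAt (deriv (deriv b)) 0 :=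
    ((hb.derivWithin (m := 1) (by norm_num)).derivWithin (m := 0) (by norm_num)).continuousAt
  have hev : ∀ᶠ s in nhds (0 : ℝ), ContDiffAt ℝ 2 b s ∧
      ‖deriv (deriv b) s‖ < ‖deriv (deriv b) 0‖ + 1 :=
    (hb.eventually (by simp)).and
      (hc.norm.eventually_lt continuousAt_const (by simp))
  obtain ⟨a, ha, hball⟩ := Metric.eventually_nhds_iff_ball.1 hev
  set M := ‖deriv (deriv b) 0‖ + 1
  have hM : 0 ≤ M := by positivity
  have hmem : ∀ s : ℝ, |s| < a → s ∈ Metric.ball (0 : ℝ) a := fun s hs => by simpa using hs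
  have h1 : ∀ s, |s| < a → ‖deriv b s - deriv b 0‖ ≤ M * |s| := by
    intro s hs
    have := (convex_ball (0 : ℝ) a).norm_image_sub_le_of_norm_deriv_le (f := deriv b) (C := M)
      (fun x hx => ((hball x hx).1.derivWithin (m := 1) (by norm_num)).differentiableAt (by simp))
      (fun x hx => (hball x hx).2.le) (hmem 0 (by simpa using ha)) (hmem s hs)
    simpa using this
  refine ⟨a, ha, M, hM, fun s hs => ⟨(hball s (hmem s hs)).1, (hball s (hmem s hs)).2.le,
    h1 s hs, ?_⟩⟩
  have hd : ∀ x, |x| < a →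
      HasDerivAt (fun x => b x - b 0 - x • deriv b 0) (deriv b x - deriv b 0) x := by
    intro x hx
    have := (((hball x (hmem x hx)).1.differentiableAt (by simp)).hasDerivAt.sub_const
      (b 0)).sub ((hasDerivAt_id x).smul_const (deriv b 0))
    simpa using! this
  have hsub : ∀ x ∈ Metric.closedBall (0 : ℝ) |s|, |x| ≤ |s| := fun x hx => by simpa using hx
  have := (convex_closedBall (0 : ℝ) |s|).norm_image_sub_le_of_norm_hasDerivWithin_le
    (f := fun x => b x - b 0 - x • deriv b 0) (C := M * |s|)
    (fun x hx => (hd x ((hsub x hx).trans_lt hs)).hasDerivWithinAt)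
    (fun x hx => (h1 x ((hsub x hx).trans_lt hs)).trans
      (mul_le_mul_of_nonneg_left (hsub x hx) hM))
    (x := 0) (y := s) (by simp) (by simp)
  simpa using this

/-- The curve `b`, bent towards the vector `D` by the smooth positive part `φ` and made straight
near the parameter `0` by the cut-off function `χ`, at the scale `ε`. The sign `τ` tells
on which side of `0` the curve `b` is used. -/
noncomputable def bentCurve (b : ℝ → Plane) (D : Plane) (φ χ : ℝ → ℝ) (τ ε : ℝ) (u : ℝ) : Plane :=
  b u + (ε * φ (τ * u / ε)) • D + (χ (τ * u / ε) - 1) • (b u - b 0 - u • deriv b 0)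

/-- The contribution of the cut-off function to the velocity of `bentCurve`. -/
noncomputable def bentError (b : ℝ → Plane) (χ : ℝ → ℝ) (τ ε : ℝ) (u : ℝ) : Plane :=
  (τ / ε * deriv χ (τ * u / ε)) • (b u - b 0 - u • deriv b 0) +
    (χ (τ * u / ε) - 1) • (deriv b u - deriv b 0)

/-- The contribution of the cut-off function to the acceleration of `bentCurve`. -/
noncomputable def bentError' (b : ℝ → Plane) (χ : ℝ → ℝ) (τ ε : ℝ) (u : ℝ) : Plane :=
  (τ / ε * (τ / ε * deriv (deriv χ) (τ * u / ε))) • (b u - b 0 - u • deriv b 0) +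
    (2 * (τ / ε * deriv χ (τ * u / ε))) • (deriv b u - deriv b 0) +
    (χ (τ * u / ε) - 1) • deriv (deriv b) u

theorem hasDerivAt_comp_scale {f : ℝ → ℝ} {f' τ ε u : ℝ} (hf : HasDerivAt f f' (τ * u / ε)) :
    HasDerivAt (fun u => f (τ * u / ε)) (τ / ε * f') u := by
  have h := hf.comp u (((hasDerivAt_id u).const_mul τ).div_const ε)
  rw [mul_one, mul_comm] at h
  exact h

theorem hasDerivAt_bentCurve {b : ℝ → Plane} {D : Plane} {φ P ρ χ : ℝ → ℝ} {τ ε u : ℝ}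
    (hφ : IsSmoothPosPart φ P ρ) (hχ : ContDiff ℝ ∞ χ) (hε : ε ≠ 0)
    (hb : ContDiffAt ℝ 2 b u) :
    HasDerivAt (bentCurve b D φ χ τ ε)
      (deriv b u + (τ * P (τ * u / ε)) • D + bentError b χ τ ε u) u := by
  have hb' : HasDerivAt b (deriv b u) u := (hb.differentiableAt (by simp)).hasDerivAt
  have h1 := (hasDerivAt_comp_scale (τ := τ) (ε := ε) (u := u)
    (hφ.hasDerivAt (τ * u / ε))).const_mul ε
  have h2 : HasDerivAt (fun u => b u - b 0 - u • deriv b 0) (deriv b u - deriv b 0) u := by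
    simpa using! (hb'.sub_const (b 0)).sub ((hasDerivAt_id u).smul_const (deriv b 0))
  have h3 := (hasDerivAt_comp_scale (τ := τ) (ε := ε) (u := u)
    ((hχ.differentiable (by simp)) (τ * u / ε)).hasDerivAt).sub_const 1
  have h4 : deriv b u + (τ * P (τ * u / ε)) • D + bentError b χ τ ε u =
      deriv b u + (ε * (τ / ε * P (τ * u / ε))) • D +
        ((χ (τ * u / ε) - 1) • (deriv b u - deriv b 0) +
          (τ / ε * deriv χ (τ * u / ε)) • (b u - b 0 - u • deriv b 0)) := by
    rw [← mul_assoc, mul_div_cancel₀ _ hε, bentError]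
    module
  rw [h4]
  exact (hb'.add (h1.smul_const D)).add (h3.smul h2)

theorem hasDerivAt_deriv_bentCurve {b : ℝ → Plane} {D : Plane} {φ P ρ χ : ℝ → ℝ} {τ ε u : ℝ}
    (hφ : IsSmoothPosPart φ P ρ) (hχ : ContDiff ℝ ∞ χ) (hτ : τ * τ = 1)
    (hb : ContDiffAt ℝ 2 b u) :
    HasDerivAt (fun u => deriv b u + (τ * P (τ * u / ε)) • D + bentError b χ τ ε u)
      (deriv (deriv b) u + bentError' b χ τ ε u + (ρ (τ * u / ε) / ε) • D) u := by
  have hb' : HasDerivAt b (deriv b u) u := (hb.differentiableAt (by simp)).hasDerivAt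
  have hb'' : HasDerivAt (deriv b) (deriv (deriv b) u) u :=
    ((hb.derivWithin (m := 1) (by norm_num)).differentiableAt (by simp)).hasDerivAt
  have h1 := (hasDerivAt_comp_scale (τ := τ) (ε := ε) (u := u)
    (hφ.hasDerivAt' (τ * u / ε))).const_mul τ
  have h2 : HasDerivAt (fun u => b u - b 0 - u • deriv b 0) (deriv b u - deriv b 0) u := by
    simpa using! (hb'.sub_const (b 0)).sub ((hasDerivAt_id u).smul_const (deriv b 0))
  have h3 := (hasDerivAt_comp_scale (τ := τ) (ε := ε) (u := u)
    ((hχ.differentiable (by simp)) (τ * u / ε)).hasDerivAt).sub_const 1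
  have h4 := (hasDerivAt_comp_scale (τ := τ) (ε := ε) (u := u)
    (((contDiff_infty_iff_deriv.1 hχ).2.differentiable
      (by simp)) (τ * u / ε)).hasDerivAt).const_mul (τ / ε)
  have h5 : τ * (τ / ε * ρ (τ * u / ε)) = ρ (τ * u / ε) / ε := by
    rw [← mul_assoc, ← mul_div_assoc, hτ]; ring
  have h6 : deriv (deriv b) u + bentError' b χ τ ε u + (ρ (τ * u / ε) / ε) • D =
      deriv (deriv b) u + (τ * (τ / ε * ρ (τ * u / ε))) • D +
        ((τ / ε * deriv χ (τ * u / ε)) • (deriv b u - deriv b 0) +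
            (τ / ε * (τ / ε * deriv (deriv χ) (τ * u / ε))) • (b u - b 0 - u • deriv b 0) +
          ((χ (τ * u / ε) - 1) • deriv (deriv b) u +
            (τ / ε * deriv χ (τ * u / ε)) • (deriv b u - deriv b 0))) := by
    rw [h5, bentError']
    module
  rw [h6]
  exact (hb''.add (h1.smul_const D)).add
    ((h4.smul h2).add (h3.smul (hb''.sub_const (deriv b 0))))

theorem exists_pos_mul_lt (K k : ℝ) (hk : 0 < k) :
    ∀ᶠ a in nhdsWithin (0 : ℝ) (Set.Ioi 0), K * a < k := by
  have h : ContinuousAt (fun a : ℝ => K * a) 0 := by fun_prop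
  exact nhdsWithin_le_nhds (h.eventually_lt continuousAt_const (by simpa using hk))

theorem abs_cross_le (a b : Plane) : |cross a b| ≤ 2 * ‖a‖ * ‖b‖ := by
  have h1 := mul_le_mul (PiLp.norm_apply_le a 0) (PiLp.norm_apply_le b 1)
    (norm_nonneg _) (norm_nonneg _)
  have h2 := mul_le_mul (PiLp.norm_apply_le a 1) (PiLp.norm_apply_le b 0)
    (norm_nonneg _) (norm_nonneg _)
  rw [← norm_mul] at h1 h2
  have h3 := norm_sub_le (a 0 * b 1) (a 1 * b 0)
  rw [cross, ← Real.norm_eq_abs]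
  linarith

theorem cross_add_right (a b c : Plane) : cross a (b + c) = cross a b + cross a c := by
  simp [cross]; ring

theorem cross_smul_self (a : Plane) (c : ℝ) : cross a (c • a) = 0 := by
  simp [cross]; ring

/-- The strict inequality makes `χ` equal to `1` on a neighbourhood, so its derivatives vanish as
well. -/
theorem bentError_eq_zero {χ : ℝ → ℝ} (hχ1 : ∀ t ≤ -1/2, χ t = 1) (b : ℝ → Plane) {τ ε s : ℝ}
    (h : τ * s / ε < -1/2) :
    χ (τ * s / ε) - 1 = 0 ∧ bentError b χ τ ε s = 0 ∧ bentError' b χ τ ε s = 0 := by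
  have hev : ∀ t : ℝ, t < -1/2 → χ =ᶠ[nhds t] fun _ => 1 := fun t ht =>
    (eventually_lt_nhds ht).mono fun u hu => hχ1 u hu.le
  have h1 : ∀ t : ℝ, t < -1/2 → deriv χ t = 0 := fun t ht => by
    rw [(hev t ht).deriv_eq, deriv_const]
  have h2 : deriv (deriv χ) (τ * s / ε) = 0 := by
    have : deriv χ =ᶠ[nhds (τ * s / ε)] fun _ => 0 :=
      (eventually_lt_nhds h).mono fun u hu => h1 u hu
    rw [this.deriv_eq, deriv_const]
  simp [bentError, bentError', h1 _ h, h2, hχ1 _ h.le]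

/-- Each derivative of the cut-off costs a factor `1/ε`, which the Taylor bounds with `|s| ≤ ε`
compensate: the errors have orders `ε²`, `ε` and `1`. -/
theorem norm_bentError_le {χ : ℝ → ℝ} {b : ℝ → Plane} {τ ε s G M : ℝ} (hτ : |τ| = 1)
    (hε : 0 < ε) (hG : 0 ≤ G) (hM : 0 ≤ M) (ht : τ * s / ε ∈ Set.Icc (-1 : ℝ) 0)
    (hχ : ∀ t ∈ Set.Icc (-1 : ℝ) 0,
      |χ t - 1| ≤ G ∧ |deriv χ t| ≤ G ∧ |deriv (deriv χ) t| ≤ G)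
    (h2 : ‖deriv (deriv b) s‖ ≤ M) (h1 : ‖deriv b s - deriv b 0‖ ≤ M * |s|)
    (h0 : ‖b s - b 0 - s • deriv b 0‖ ≤ M * |s| * |s|) :
    ‖(χ (τ * s / ε) - 1) • (b s - b 0 - s • deriv b 0)‖ ≤ G * M * ε * ε ∧
      ‖bentError b χ τ ε s‖ ≤ 2 * G * M * ε ∧ ‖bentError' b χ τ ε s‖ ≤ 4 * G * M := by
  obtain ⟨g0, g1, g2⟩ := hχ _ ht
  have hs : |s| ≤ ε := by
    have h : |τ * s / ε| ≤ 1 := abs_le.2 ⟨ht.1, by linarith [ht.2]⟩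
    rw [abs_div, abs_mul, hτ, one_mul, abs_of_pos hε, div_le_one hε] at h
    exact h
  have hs0 := abs_nonneg s
  have h1' : ‖deriv b s - deriv b 0‖ ≤ M * ε := h1.trans (by gcongr)
  have h0' : ‖b s - b 0 - s • deriv b 0‖ ≤ M * ε * ε := h0.trans (by gcongr)
  have e1 : |τ / ε * deriv χ (τ * s / ε)| ≤ G / ε := by
    rw [abs_mul, abs_div, hτ, abs_of_pos hε, one_div, inv_mul_eq_div]
    gcongr
  have e2 : |τ / ε * (τ / ε * deriv (deriv χ) (τ * s / ε))| ≤ G / ε / ε := by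
    rw [abs_mul, abs_mul, abs_div, hτ, abs_of_pos hε, one_div, inv_mul_eq_div, inv_mul_eq_div]
    gcongr
  have e3 : |2 * (τ / ε * deriv χ (τ * s / ε))| ≤ 2 * (G / ε) := by
    rw [abs_mul, abs_two]
    gcongr
  refine ⟨?_, ?_, ?_⟩
  · rw [norm_smul, Real.norm_eq_abs]
    calc _ ≤ G * (M * ε * ε) := by gcongr
      _ = _ := by ring
  · refine (norm_add_le _ _).trans ?_
    rw [norm_smul, norm_smul, Real.norm_eq_abs, Real.norm_eq_abs]
    calc _ ≤ G / ε * (M * ε * ε) + G * (M * ε) := by gcongr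
      _ = _ := by field_simp; ring
  · refine (norm_add₃_le).trans ?_
    rw [norm_smul, norm_smul, norm_smul, Real.norm_eq_abs, Real.norm_eq_abs, Real.norm_eq_abs]
    calc _ ≤ G / ε / ε * (M * ε * ε) + 2 * (G / ε) * (M * ε) + G * M := by gcongr
      _ = _ := by field_simp; ring

/-- The local properties of `bentCurve` on the side of `0` given by the sign `τ`. The sign `η` is
the sense of the turn. -/
theorem bentCurve_spec {b : ℝ → Plane} {e D : Plane} {φ P ρ χ : ℝ → ℝ} {τ η G : ℝ}
    (hφ : IsSmoothPosPart φ P ρ) (hχs : ContDiff ℝ ∞ χ) (hχ1 : ∀ t ≤ -1/2, χ t = 1) (hG : 0 ≤ G)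
    (hχ : ∀ t ∈ Set.Icc (-1 : ℝ) 0,
      |χ t - 1| ≤ G ∧ |deriv χ t| ≤ G ∧ |deriv (deriv χ) t| ≤ G)
    (hτ : |τ| = 1) (hη : |η| = 1) (hb : ContDiffAt ℝ 2 b 0) (hp : 0 < b 0 1)
    (he : 0 < inner ℝ e (deriv b 0)) (heD : inner ℝ e D = 0) (hD : 0 < η * cross D (deriv b 0)) :
    ∃ C : ℝ, ∀ᶠ a in nhdsWithin (0 : ℝ) (Set.Ioi 0), ∀ ε, 0 < ε → ε < a →
      ∀ s, |s| < a → τ * s ≤ 0 → ∀ r : ℝ → Plane, r =ᶠ[nhds s] bentCurve b D φ χ τ ε →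
      DifferentiableAt ℝ r s ∧ 0 < inner ℝ e (deriv r s) ∧
      (-ε ≤ τ * s → ‖r s - b 0‖ ≤ C * ε) ∧
      (-ε < τ * s → η * revolutionMeanCurvature b s ≤ η * revolutionMeanCurvature r s) := by
  obtain ⟨a₀, ha₀, M, hM, hb'⟩ := exists_taylor_bound hb
  obtain ⟨m, hm, hρm⟩ := hφ.second_pos
  set T := deriv b 0
  set p := b 0
  -- `κ` and `c` are half of the values at the corner; the other half absorbs the perturbation on
  -- the window `|s| < a`.
  set κ := inner ℝ e T / 2 with hκ
  have hκ0 : 0 < κ := by positivity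
  set c := η * cross D T / 2 with hc
  have hc0 : 0 < c := by positivity
  set N := ‖T‖ + ‖D‖ + M + 4 * G * M with hN
  have hGM : 0 ≤ G * M := mul_nonneg hG hM
  obtain ⟨L, hL, hLip⟩ := curvatureSum_lipschitz p e hp hκ0 N
  set C := ‖T‖ + M + ‖D‖ + G * M with hC
  have hC0 : 0 ≤ C := by positivity
  -- `2 * ‖D‖` accounts for the `φ` and `P` terms; `7 = 1 + 2 + 4` collects the cut-off errors in
  -- position, velocity and acceleration.
  set C₁ := 2 * ‖D‖ + 7 * (G * M) / m with hC₁
  have hC₁0 : 0 ≤ C₁ := by positivity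
  have hN0 : 0 < N + 1 := by positivity
  refine ⟨C, ?_⟩
  filter_upwards [exists_pos_mul_lt 1 a₀ ha₀, exists_pos_mul_lt 1 1 one_pos,
    exists_pos_mul_lt (‖e‖ * (M + 2 * (G * M))) κ hκ0, exists_pos_mul_lt C (p 1 / 2) (by positivity),
    exists_pos_mul_lt (2 * ‖D‖ * (M + 2 * (G * M))) c hc0,
    exists_pos_mul_lt (L * C₁) (c / (N + 1) ^ 3) (by positivity)]
    with a h1 h2 h3 h4 h5 h6 ε hε hεa s hs hτs r hr
  rw [one_mul] at h1 h2
  obtain ⟨hbs, b2, b1, b0⟩ := hb' s (hs.trans h1)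
  have hs0 := abs_nonneg s
  have hε1 : ε ≤ 1 := by linarith
  set t := τ * s / ε with ht
  have ht0 : t ≤ 0 := div_nonpos_of_nonpos_of_nonneg hτs hε.le
  have htl : -ε ≤ τ * s → -1 ≤ t := fun h => by
    rw [ht, le_div_iff₀ hε]; linarith
  have hττ : τ * τ = 1 := by rw [← abs_mul_abs_self, hτ, one_mul]
  have hbb : ∀ u, |u| < a → ContDiffAt ℝ 2 b u := fun u hu => (hb' u (hu.trans h1)).1
  have hnear : ∀ᶠ u in nhds s, |u| < a := continuous_abs.continuousAt.eventually_lt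
    continuousAt_const hs
  set v : ℝ → Plane := fun u => deriv b u + (τ * P (τ * u / ε)) • D + bentError b χ τ ε u with hv
  have hder : ∀ u, |u| < a → HasDerivAt (bentCurve b D φ χ τ ε) (v u) u := fun u hu =>
    hasDerivAt_bentCurve hφ hχs hε.ne' (hbb u hu)
  have hr1 : HasDerivAt r (v s) s := (hder s hs).congr_of_eventuallyEq hr
  have hrv : deriv r =ᶠ[nhds s] v := hr.deriv.trans (hnear.mono fun u hu => (hder u hu).deriv)
  set γ := bentError' b χ τ ε s with hγ
  have hr2 : deriv (deriv r) s = deriv (deriv b) s + γ + (ρ t / ε) • D := by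
    rw [hrv.deriv_eq]
    exact (hasDerivAt_deriv_bentCurve hφ hχs hττ hbs).deriv
  have hrs : r s = b s + (ε * φ t) • D + (χ t - 1) • (b s - p - s • T) := hr.self_of_nhds
  set Z := (χ t - 1) • (b s - p - s • T) with hZ
  set Z' := bentError b χ τ ε s with hZ'
  have hvs : v s = deriv b s + (τ * P t) • D + Z' := rfl
  -- Either the cut-off is inactive, or `t ≥ -1/2`, where `ρ t ≥ m` can pay for its errors.
  have hdich : (Z = 0 ∧ Z' = 0 ∧ γ = 0) ∨ (-1/2 ≤ t ∧ ‖Z‖ ≤ G * M * ε * ε ∧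
      ‖Z'‖ ≤ 2 * G * M * ε ∧ ‖γ‖ ≤ 4 * G * M) := by
    rcases lt_or_ge t (-1/2) with h | h
    · obtain ⟨z0, z1, z2⟩ := bentError_eq_zero hχ1 b h
      exact Or.inl ⟨by rw [hZ, z0, zero_smul], z1, z2⟩
    · exact Or.inr ⟨h, norm_bentError_le hτ hε hG hM ⟨by linarith, ht0⟩ hχ b2 b1 b0⟩
  have hZb : ‖Z‖ ≤ G * M * ε := by
    rcases hdich with ⟨h, -, -⟩ | ⟨-, h, -, -⟩
    · rw [h, norm_zero]; positivity
    · exact h.trans (mul_le_of_le_one_right (by positivity) hε1)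
  have hZ'b : ‖Z'‖ ≤ 2 * (G * M) * ε := by
    rcases hdich with ⟨-, h, -⟩ | ⟨-, -, h, -⟩
    · rw [h, norm_zero]; positivity
    · linarith
  have hγb : ‖γ‖ ≤ 4 * G * M := by
    rcases hdich with ⟨-, -, h⟩ | ⟨-, -, -, h⟩
    · rw [h, norm_zero]; positivity
    · exact h
  have hTa : ‖deriv b s - T‖ ≤ M * a := b1.trans (by gcongr)
  have hdev : ‖(deriv b s - T) + Z'‖ ≤ (M + 2 * (G * M)) * a := by
    refine (norm_add_le _ _).trans ?_
    have : 2 * (G * M) * ε ≤ 2 * (G * M) * a := by gcongr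
    linarith
  have hbe : ∀ y : Plane, ‖y‖ ≤ (M + 2 * (G * M)) * a → κ ≤ inner ℝ e (T + y) := by
    intro y hy
    have h7 := (abs_le.1 (abs_real_inner_le_norm e y)).1
    have h8 : ‖e‖ * ‖y‖ ≤ ‖e‖ * ((M + 2 * (G * M)) * a) := by gcongr
    rw [inner_add_right]
    linarith
  -- The bending term `(τ * P t) • D` need not be small, but it is orthogonal to `e`.
  have hev : κ ≤ inner ℝ e (v s) := by
    have h7 := hbe _ hdev
    have h8 : v s = T + (deriv b s - T + Z') + (τ * P t) • D := by rw [hvs]; abel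
    rw [h8, inner_add_right, inner_smul_right, heD, mul_zero, add_zero]
    exact h7
  have hev0 : κ ≤ inner ℝ e (deriv b s) := by
    have := hbe (deriv b s - T) (hTa.trans (by
      have : 0 ≤ a := hε.le.trans hεa.le
      gcongr; linarith))
    rwa [add_sub_cancel] at this
  have hPt := hφ.deriv_mem t
  have hbp : ‖b s - p‖ ≤ (‖T‖ + M) * |s| := by
    have h7 : b s - p = (b s - p - s • T) + s • T := by abel
    rw [h7]
    refine (norm_add_le _ _).trans ?_
    rw [norm_smul, Real.norm_eq_abs]
    have h8 : M * |s| * |s| ≤ M * |s| :=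
      mul_le_of_le_one_right (by positivity) (by linarith)
    linarith
  have hpos : -ε ≤ τ * s → ‖r s - p‖ ≤ C * ε := by
    intro h
    have hsε : |s| ≤ ε := by
      have h8 : |τ * s| ≤ ε := abs_le.2 ⟨h, by linarith⟩
      rwa [abs_mul, hτ, one_mul] at h8
    have h7 : r s - p = (b s - p) + (ε * φ t) • D + Z := by rw [hrs]; abel
    rw [h7]
    refine norm_add₃_le.trans ?_
    rw [norm_smul, Real.norm_eq_abs, abs_of_nonneg (mul_nonneg hε.le (hφ.nonneg t))]
    have h8 : φ t ≤ 1 := (hφ.le t ⟨htl h, ht0⟩).trans hPt.2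
    have h9 : ε * φ t * ‖D‖ ≤ ε * 1 * ‖D‖ := by gcongr
    have h10 : (‖T‖ + M) * |s| ≤ (‖T‖ + M) * ε := by gcongr
    rw [hC]
    linarith
  refine ⟨hr1.differentiableAt, by rw [hr1.deriv]; linarith, hpos, fun hτε => ?_⟩
  have ht1 : -1 ≤ t := htl hτε.le
  have htm : t ∈ Set.Icc (-1 : ℝ) 0 := ⟨ht1, ht0⟩
  have hpC : ‖r s - p‖ ≤ p 1 / 2 := (hpos hτε.le).trans (by
    have : C * ε ≤ C * a := by gcongr
    linarith)
  have hbC : ‖b s - p‖ ≤ p 1 / 2 := hbp.trans (by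
    have : (‖T‖ + M) * |s| ≤ C * a := by
      gcongr
      rw [hC]; linarith [norm_nonneg D]
    linarith)
  have hpos1 : ∀ x : Plane, ‖x - p‖ ≤ p 1 / 2 → 0 < x 1 := by
    intro x hx
    have h := (PiLp.norm_apply_le (x - p) 1).trans hx
    rw [PiLp.sub_apply, Real.norm_eq_abs, abs_le] at h
    linarith [h.1]
  have hne : ∀ x : Plane, κ ≤ inner ℝ e x → x ≠ 0 := by
    rintro x hx rfl
    rw [inner_zero_right] at hx
    linarith
  have hrC2 : ContDiffAt ℝ 2 r s := by
    refine ContDiffAt.congr_of_eventuallyEq ?_ hr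
    have hφc : ContDiff ℝ 2 φ := contDiff_infty.1 hφ.contDiff 2
    have hχc : ContDiff ℝ 2 χ := contDiff_infty.1 hχs 2
    unfold bentCurve
    have hl : ContDiff ℝ 2 fun u : ℝ => τ * u / ε := by fun_prop
    exact (hbs.add ((contDiff_const.mul (hφc.comp hl)).contDiffAt.smul contDiffAt_const)).add
      (((hχc.comp hl).contDiffAt.sub contDiffAt_const).smul
        ((hbs.sub contDiffAt_const).sub (contDiffAt_id.smul contDiffAt_const)))
  rw [revolutionMeanCurvature_eq hrC2 (hpos1 _ hpC) (by rw [hr1.deriv]; exact hne _ hev),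
    revolutionMeanCurvature_eq hbs (hpos1 _ hbC) (hne _ hev0), hr1.deriv, hr2,
    curvatureSum_add_smul]
  have hbn : ‖deriv b s‖ ≤ ‖T‖ + M := by
    have h7 : deriv b s = T + (deriv b s - T) := by abel
    rw [h7]
    refine (norm_add_le _ _).trans ?_
    have : M * a ≤ M := mul_le_of_le_one_right hM h2.le
    linarith
  have hτP : ‖(τ * P t) • D‖ ≤ P t * ‖D‖ := by
    rw [norm_smul, Real.norm_eq_abs, abs_mul, hτ, one_mul, abs_of_nonneg hPt.1]
  have hvn : ‖v s‖ ≤ N := by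
    rw [hvs]
    refine norm_add₃_le.trans ?_
    have h7 : P t * ‖D‖ ≤ ‖D‖ := mul_le_of_le_one_left (norm_nonneg _) hPt.2
    have h8 : 2 * (G * M) * ε ≤ 2 * (G * M) := mul_le_of_le_one_right (by positivity) hε1
    rw [hN]
    linarith
  have hρ0 := hφ.second_nonneg t
  -- The acceleration of `r` enters here without its part `(ρ t / ε) • D`.
  have hlip := hLip (r s) (v s) (deriv (deriv b) s + γ) (b s) (deriv b s) (deriv (deriv b) s)
    hpC hbC hev hev0 hvn (by rw [hN]; linarith [norm_nonneg D])
    ((norm_add_le _ _).trans (by rw [hN]; linarith [norm_nonneg D, norm_nonneg T]))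
    (by rw [hN]; linarith [norm_nonneg D, norm_nonneg T])
  have hsum : ‖r s - b s‖ + ‖v s - deriv b s‖ + ‖deriv (deriv b) s + γ - deriv (deriv b) s‖ ≤
      C₁ * ρ t := by
    have h7 : r s - b s = (ε * φ t) • D + Z := by rw [hrs]; abel
    have h8 : v s - deriv b s = (τ * P t) • D + Z' := by rw [hvs]; abel
    rw [h7, h8, add_sub_cancel_left]
    have h9 : ‖(ε * φ t) • D‖ ≤ ρ t * ‖D‖ := by
      rw [norm_smul, Real.norm_eq_abs, abs_of_nonneg (mul_nonneg hε.le (hφ.nonneg t))]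
      have : ε * φ t ≤ φ t := mul_le_of_le_one_left (hφ.nonneg t) hε1
      have := hφ.le t htm
      have := hφ.deriv_le t htm
      gcongr
      linarith
    have h10 : P t * ‖D‖ ≤ ρ t * ‖D‖ := by gcongr; exact hφ.deriv_le t htm
    have h11 : ‖Z‖ + ‖Z'‖ + ‖γ‖ ≤ 7 * (G * M) / m * ρ t := by
      rcases hdich with ⟨z0, z1, z2⟩ | ⟨z, -⟩
      · rw [z0, z1, z2, norm_zero]
        have : 0 ≤ 7 * (G * M) / m * ρ t := by positivity
        linarith
      · have h12 : 7 * (G * M) / m * m ≤ 7 * (G * M) / m * ρ t := by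
          gcongr; exact hρm t ⟨z, ht0⟩
        rw [div_mul_cancel₀ _ hm.ne'] at h12
        have h13 : G * M * ε ≤ G * M := mul_le_of_le_one_right hGM hε1
        linarith
    have h14 := norm_add_le ((ε * φ t) • D) Z
    have h15 := norm_add_le ((τ * P t) • D) Z'
    rw [hC₁]
    linarith
  -- Bending is along `D`, so it does not change `cross D (v s)`.
  have hgain : c ≤ η * cross D (v s) := by
    have h8 : v s = T + (deriv b s - T + Z') + (τ * P t) • D := by rw [hvs]; abel
    rw [h8, cross_add_right, cross_add_right, cross_smul_self, add_zero, mul_add]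
    have h9 : |η * cross D (deriv b s - T + Z')| ≤ c := by
      rw [abs_mul, hη, one_mul]
      refine (abs_cross_le _ _).trans ?_
      have : 2 * ‖D‖ * ‖deriv b s - T + Z'‖ ≤ 2 * ‖D‖ * ((M + 2 * (G * M)) * a) := by gcongr
      linarith
    have := (abs_le.1 h9).1
    linarith
  have hvn0 : 0 < ‖v s‖ := norm_pos_iff.2 (hne _ hev)
  have hq : c / (N + 1) ^ 3 * ρ t / ε ≤ η * (ρ t / ε * (cross D (v s) / ‖v s‖ ^ 3)) := by
    have h7 : c / (N + 1) ^ 3 ≤ η * cross D (v s) / ‖v s‖ ^ 3 :=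
      div_le_div₀ (hc0.le.trans hgain) hgain (pow_pos hvn0 3)
        (pow_le_pow_left₀ hvn0.le (hvn.trans (le_add_of_nonneg_right zero_le_one)) 3)
    calc c / (N + 1) ^ 3 * ρ t / ε ≤ η * cross D (v s) / ‖v s‖ ^ 3 * ρ t / ε := by gcongr
      _ = _ := by ring
  -- The decisive comparison: gain and loss share the factor `ρ t`, which may vanish, and `1/ε`
  -- outweighs the constants.
  have hLC : L * (C₁ * ρ t) ≤ c / (N + 1) ^ 3 * ρ t / ε := by
    rw [le_div_iff₀ hε]
    have h7 : L * C₁ * ε ≤ c / (N + 1) ^ 3 := by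
      have : L * C₁ * ε ≤ L * C₁ * a := by gcongr
      linarith
    calc L * (C₁ * ρ t) * ε = L * C₁ * ε * ρ t := by ring
      _ ≤ _ := by gcongr
  have hfin : |η * (curvatureSum (r s) (v s) (deriv (deriv b) s + γ) -
      curvatureSum (b s) (deriv b s) (deriv (deriv b) s))| ≤ L * (C₁ * ρ t) := by
    rw [abs_mul, hη, one_mul]
    exact hlip.trans (by gcongr)
  have := (abs_le.1 hfin).1
  linarith

/-! ### Global embeddedness -/

/-- Injectivity alone would allow remote parts of the curve to accumulate at `r 0`; the inducing
topology forbids it. -/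
theorem exists_le_dist_of_isEmbedding {r : ℝ → Plane} {I : Set ℝ}
    (h : Topology.IsEmbedding (I.domRestrict r)) (h0 : (0 : ℝ) ∈ I) {a : ℝ} (ha : 0 < a) :
    ∃ d > 0, ∀ s ∈ I, a ≤ |s| → d ≤ dist (r s) (r 0) := by
  have hmem : {x : I | |(x : ℝ)| < a} ∈ nhds (⟨0, h0⟩ : I) :=
    (continuous_subtype_val.abs).continuousAt.eventually_lt continuousAt_const (by simpa using ha)
  rw [h.isInducing.nhds_eq_comap, Filter.mem_comap] at hmem
  obtain ⟨V, hV, hsub⟩ := hmem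
  obtain ⟨d, hd, hball⟩ := Metric.mem_nhds_iff.1 hV
  refine ⟨d, hd, fun s hs has => ?_⟩
  by_contra! hlt
  have : (⟨s, hs⟩ : I) ∈ I.domRestrict r ⁻¹' V := hball hlt
  exact absurd (hsub this) (not_lt.2 has)

/-- A continuous injective curve that agrees with an embedded one outside a small
parameter interval, and there stays away from the rest of its image, is embedded. -/
theorem isEmbedding_of_eq_outside {J : Set ℝ} {f c : ℝ → Plane} {p : Plane} {a d ε : ℝ}
    (hf : ContinuousOn f J) (hinj : Set.InjOn f J)
    (hc : Topology.IsEmbedding (J.domRestrict c)) (hJ : Set.Icc (-a) a ⊆ J) (hεa : ε ≤ a)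
    (heq : ∀ s ∈ J, ε ≤ |s| → f s = c s) (hfar : ∀ s ∈ J, a ≤ |s| → d ≤ dist (f s) p)
    (hnear : ∀ s, |s| ≤ ε → dist (f s) p < d) :
    Topology.IsEmbedding (J.domRestrict f) := by
  have hf' : Continuous (J.domRestrict f) := continuousOn_iff_continuous_domRestrict.1 hf
  have hinj' : Function.Injective (J.domRestrict f) := Set.injOn_iff_injective.1 hinj
  have hK : ∀ b ≤ a, IsCompact {x : J | |(x : ℝ)| ≤ b} := by
    intro b hb
    rw [Topology.IsInducing.subtypeVal.isCompact_iff]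
    have : Subtype.val '' {x : J | |(x : ℝ)| ≤ b} = Set.Icc (-b) b := by
      ext s
      simp only [Set.mem_image, Set.mem_ofPred_eq, Subtype.exists, exists_and_left, exists_prop,
        exists_eq_right_right, Set.mem_Icc, ← abs_le, and_iff_left_iff_imp]
      exact fun h => hJ (abs_le.1 (h.trans hb))
    rw [this]
    exact isCompact_Icc
  refine ⟨Topology.isInducing_iff_nhds.2 fun x => le_antisymm hf'.continuousAt.le_comap ?_, hinj'⟩
  -- An ultrafilter whose image converges to `f x` either lives on a compact parameter interval,
  -- where compactness and injectivity force the limit `x`, or lives where `f = c`, and then the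
  -- embedding `c` applies.
  rw [Filter.le_iff_ultrafilter]
  intro U hU
  have hUx : Filter.Tendsto (J.domRestrict f) U (nhds (f x)) := Filter.map_le_iff_le_comap.2 hU
  have hcpt : ∀ b ≤ a, {x : J | |(x : ℝ)| ≤ b} ∈ U → (U : Filter J) ≤ nhds x := by
    intro b hb hbU
    obtain ⟨y, -, hy⟩ := (hK b hb).ultrafilter_le_nhds' U hbU
    have hxy := tendsto_nhds_unique ((hf'.tendsto y).mono_left hy) hUx
    rwa [← hinj' hxy]
  rcases le_or_gt |(x : ℝ)| ε with hx | hx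
  · refine hcpt a le_rfl ?_
    have hlt : ∀ᶠ y : J in (U : Filter J), dist (f y) p < d :=
      (hUx.dist tendsto_const_nhds).eventually_lt_const (hnear x hx)
    filter_upwards [hlt] with y hy
    by_contra! h
    exact absurd (hfar y y.2 h.le) (not_le.2 hy)
  · rcases U.mem_or_compl_mem {y : J | |(y : ℝ)| ≤ ε} with hU' | hU'
    · exact hcpt ε hεa hU'
    · rw [hc.isInducing.nhds_eq_comap, ← Filter.map_le_iff_le_comap]
      have hcx : J.domRestrict c x = f x := (heq x x.2 hx.le).symm
      rw [hcx]
      refine Filter.Tendsto.congr' ?_ hUx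
      filter_upwards [hU'] with y hy
      exact heq y y.2 (le_of_lt (not_le.1 hy))

/-! ### Assembling the round corner -/

/-- The curve that runs along `r₁`, then straight along its tangent at the corner, is bent
into the tangent of `r₂`, and continues along `r₂`. -/
noncomputable def roundedCurve (r₁ r₂ : ℝ → Plane) (φ χ : ℝ → ℝ) (ε s : ℝ) : Plane :=
  r₁ 0 + s • deriv r₁ 0 + (ε * φ (s / ε)) • (deriv r₂ 0 - deriv r₁ 0) +
    χ (s / ε) • (r₁ s - r₁ 0 - s • deriv r₁ 0) + χ (-s / ε) • (r₂ s - r₂ 0 - s • deriv r₂ 0)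

section

variable {r₁ r₂ : ℝ → Plane} {φ P ρ χ : ℝ → ℝ} {ε s : ℝ}

theorem roundedCurve_eq_left (hε : 0 < ε) (hχ0 : ∀ t, -1/4 ≤ t → χ t = 0) (hs : s ≤ ε / 4) :
    roundedCurve r₁ r₂ φ χ ε s = bentCurve r₁ (deriv r₂ 0 - deriv r₁ 0) φ χ 1 ε s := by
  have h : χ (-s / ε) = 0 := hχ0 _ (by rw [le_div_iff₀ hε]; linarith)
  rw [roundedCurve, bentCurve, h, one_mul]
  module

/-- Since `ε φ(s/ε) = ε φ(-s/ε) + s`, the first tangent line plus `s • D` becomes the second one.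
The left and right descriptions overlap on `[-ε/4, ε/4]`, so smoothness at `0` needs no gluing
argument. -/
theorem roundedCurve_eq_right (hφ : IsSmoothPosPart φ P ρ) (h0 : r₁ 0 = r₂ 0) (hε : 0 < ε)
    (hχ0 : ∀ t, -1/4 ≤ t → χ t = 0) (hs : -(ε / 4) ≤ s) :
    roundedCurve r₁ r₂ φ χ ε s = bentCurve r₂ (deriv r₂ 0 - deriv r₁ 0) φ χ (-1) ε s := by
  have h : χ (s / ε) = 0 := hχ0 _ (by rw [le_div_iff₀ hε]; linarith)
  have h1 : ε * φ (s / ε) = ε * φ (-s / ε) + s := by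
    have h2 := hφ.sub_neg (s / ε)
    rw [← neg_div] at h2
    rw [sub_eq_iff_eq_add.1 h2, mul_add, mul_div_cancel₀ _ hε.ne', add_comm]
  rw [roundedCurve, bentCurve, h, h1, h0, neg_one_mul]
  module

theorem bentCurve_eq_self (hφ : IsSmoothPosPart φ P ρ) (hχ1 : ∀ t ≤ -1/2, χ t = 1) (hε : 0 < ε)
    {b : ℝ → Plane} {D : Plane} {τ : ℝ} (hs : τ * s ≤ -ε) : bentCurve b D φ χ τ ε s = b s := by
  have h : τ * s / ε ≤ -1 := by rw [div_le_iff₀ hε]; linarith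
  rw [bentCurve, hφ.eq_zero _ h, hχ1 _ (by linarith)]
  module

theorem contDiffAt_bentCurve (hφ : IsSmoothPosPart φ P ρ) (hχ : ContDiff ℝ ∞ χ)
    {b : ℝ → Plane} {D : Plane} {τ : ℝ} (hb : ContDiffAt ℝ ∞ b s) :
    ContDiffAt ℝ ∞ (bentCurve b D φ χ τ ε) s := by
  have hl : ContDiff ℝ ∞ fun u : ℝ => τ * u / ε := by fun_prop
  exact (hb.add ((contDiff_const.mul (hφ.contDiff.comp hl)).contDiffAt.smul contDiffAt_const)).add
    (((hχ.comp hl).contDiffAt.sub contDiffAt_const).smul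
      ((hb.sub contDiffAt_const).sub (contDiffAt_id.smul contDiffAt_const)))

end

theorem inner_unitTangent_unitNormal {r₁ r₂ : ℝ → Plane} (h₁ : ‖deriv r₁ 0‖ = 1)
    (h₂ : ‖deriv r₂ 0‖ = 1) :
    inner ℝ (unitTangent r₂ 0) (unitNormal r₁ 0) = cross (deriv r₂ 0) (deriv r₁ 0) := by
  simp [unitNormal, unitTangent, h₁, h₂, cross, PiLp.inner_apply, Fin.sum_univ_two]
  ring

/-- From `⟨v, w⟩² + (cross w v)² = 1`: transversality excludes opposite tangents, so `T₁ + T₂` has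
positive inner product with both. -/
theorem inner_pos_of_cross_ne_zero {v w : Plane} (hv : ‖v‖ = 1) (hw : ‖w‖ = 1)
    (h : cross w v ≠ 0) : 0 < 1 + inner ℝ v w := by
  have h1 : v 0 ^ 2 + v 1 ^ 2 = 1 := by
    have := EuclideanSpace.norm_sq_eq v
    rw [hv] at this
    simpa [Fin.sum_univ_two] using this.symm
  have h2 : w 0 ^ 2 + w 1 ^ 2 = 1 := by
    have := EuclideanSpace.norm_sq_eq w
    rw [hw] at this
    simpa [Fin.sum_univ_two] using this.symm
  have h3 : inner ℝ v w = v 0 * w 0 + v 1 * w 1 := by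
    simp [PiLp.inner_apply, Fin.sum_univ_two, mul_comm]
  have h4 : (inner ℝ v w) ^ 2 + cross w v ^ 2 = 1 := by
    rw [h3, cross]
    linear_combination (w 0 ^ 2 + w 1 ^ 2) * h1 + h2
  have h5 : 0 < cross w v ^ 2 := by positivity
  nlinarith

/-- The round-corner lemma for both senses of turning, which the sign `η` tells apart. -/
theorem exists_isRoundCorner {r₁ r₂ : ℝ → Plane} {I₁ I₂ : Set ℝ} {p : Plane} {η : ℝ}
    (h₁ : IsEmbeddedArcLengthCurve r₁ I₁) (h₂ : IsEmbeddedArcLengthCurve r₂ I₂)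
    (h0₁ : (0 : ℝ) ∈ I₁) (hneg : ∃ s ∈ I₁, s < 0) (h0₂ : (0 : ℝ) ∈ I₂) (hpos : ∃ s ∈ I₂, 0 < s)
    (hp₁ : r₁ 0 = p) (hp₂ : r₂ 0 = p) (hinter : r₁ '' I₁ ∩ r₂ '' I₂ = {p}) (hη : |η| = 1)
    (hturn : 0 < η * inner ℝ (unitTangent r₂ 0) (unitNormal r₁ 0))
    {δ : ℝ} (hδ : 0 < δ) {ε₀ : ℝ} (hε₀ : 0 < ε₀) :
    ∃ ε : ℝ, 0 < ε ∧ ε < ε₀ ∧ ∃ r : ℝ → Plane, IsRoundCorner r₁ r₂ I₁ I₂ p δ ε r ∧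
      (∀ s ∈ Set.Ioo (-ε) 0,
        η * revolutionMeanCurvature r₁ s ≤ η * revolutionMeanCurvature r s) ∧
      (∀ s ∈ Set.Ioo 0 ε,
        η * revolutionMeanCurvature r₂ s ≤ η * revolutionMeanCurvature r s) := by
  obtain ⟨φ, P, ρ, hφ⟩ := exists_smoothPosPart
  obtain ⟨χ, hχs, hχ1, hχ0, G, hG, hχ⟩ := exists_cutoff
  have hT₁ := h₁.arcLength 0 h0₁
  have hT₂ := h₂.arcLength 0 h0₂
  rw [inner_unitTangent_unitNormal hT₁ hT₂] at hturn
  have he : 0 < 1 + inner ℝ (deriv r₁ 0) (deriv r₂ 0) :=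
    inner_pos_of_cross_ne_zero hT₁ hT₂ (right_ne_zero_of_mul hturn.ne')
  set D := deriv r₂ 0 - deriv r₁ 0 with hD
  set e := deriv r₁ 0 + deriv r₂ 0 with he'
  have heD : inner ℝ e D = 0 := by
    rw [hD, he', add_comm, real_inner_add_sub_eq_zero_iff, hT₁, hT₂]
  have he₁ : 0 < inner ℝ e (deriv r₁ 0) := by
    rw [he', inner_add_left, real_inner_self_eq_norm_sq, hT₁, real_inner_comm]
    simpa using he
  have he₂ : 0 < inner ℝ e (deriv r₂ 0) := by
    rw [he', inner_add_left, real_inner_self_eq_norm_sq, hT₂]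
    linarith
  have hp1 : 0 < p 1 := hp₁ ▸ h₁.halfPlane 0 h0₁
  have hC2 : ∀ {r : ℝ → Plane} {I : Set ℝ}, IsEmbeddedArcLengthCurve r I → (0 : ℝ) ∈ I →
      ContDiffAt ℝ 2 r 0 := fun h h0 => contDiffAt_infty.1 (h.smooth 0 h0) 2
  -- Both `cross D T₁` and `cross D T₂` equal `cross T₂ T₁`, so one sign `η` serves both sides.
  obtain ⟨C₁, hloc₁⟩ := bentCurve_spec (b := r₁) (e := e) (D := D) (τ := 1) (η := η) hφ hχs hχ1 hG
    hχ (by simp) hη (hC2 h₁ h0₁) (by rwa [hp₁]) he₁ heD (by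
      have : cross D (deriv r₁ 0) = cross (deriv r₂ 0) (deriv r₁ 0) := by
        simp [hD, cross]; ring
      rwa [this])
  obtain ⟨C₂, hloc₂⟩ := bentCurve_spec (b := r₂) (e := e) (D := D) (τ := -1) (η := η) hφ hχs hχ1 hG
    hχ (by simp) hη (hC2 h₂ h0₂) (by rwa [hp₂]) he₂ heD (by
      have : cross D (deriv r₂ 0) = cross (deriv r₂ 0) (deriv r₁ 0) := by
        simp [hD, cross]; ring
      rwa [this])
  obtain ⟨s₁, hs₁I, hs₁⟩ := hneg
  obtain ⟨s₂, hs₂I, hs₂⟩ := hpos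
  -- The window `a` is fixed before `ε`: it determines the distance `d` of the remote parts from
  -- `p`, and `ε` is then chosen in terms of `d`.
  obtain ⟨a, hspec₁, hspec₂, has₁, has₂, ha⟩ := (hloc₁.and (hloc₂.and
    ((exists_pos_mul_lt 1 (-s₁) (by linarith)).and ((exists_pos_mul_lt 1 s₂ hs₂).and
      self_mem_nhdsWithin)))).exists
  rw [one_mul] at has₁ has₂
  have hI₁ : ∀ s, -a ≤ s → s ≤ 0 → s ∈ I₁ := fun s h h' =>
    h₁.ordConnected.out hs₁I h0₁ ⟨by linarith, h'⟩
  have hI₂ : ∀ s, 0 ≤ s → s ≤ a → s ∈ I₂ := fun s h h' =>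
    h₂.ordConnected.out h0₂ hs₂I ⟨h, by linarith⟩
  obtain ⟨d₁, hd₁, hfar₁⟩ := exists_le_dist_of_isEmbedding h₁.embedding h0₁ (half_pos ha)
  obtain ⟨d₂, hd₂, hfar₂⟩ := exists_le_dist_of_isEmbedding h₂.embedding h0₂ (half_pos ha)
  rw [hp₁] at hfar₁
  rw [hp₂] at hfar₂
  -- `d₁`, `d₂` separate the corner from the remote parts, `δ` gives the required closeness, and `p
  -- 1` keeps the corner in the half-plane.
  set d := min (min d₁ d₂) (min δ (p 1)) with hd
  have hd0 : 0 < d := lt_min (lt_min hd₁ hd₂) (lt_min hδ hp1)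
  obtain ⟨ε, hεa, hεε₀, hεC₁, hεC₂, hε⟩ := ((exists_pos_mul_lt 1 (a / 2) (by linarith)).and
    ((exists_pos_mul_lt 1 ε₀ hε₀).and ((exists_pos_mul_lt C₁ d hd0).and
      ((exists_pos_mul_lt C₂ d hd0).and self_mem_nhdsWithin)))).exists
  rw [one_mul] at hεa hεε₀
  set r := roundedCurve r₁ r₂ φ χ ε with hr
  set J := cornerDomain I₁ I₂ with hJ
  have hleft : ∀ s ≤ 0, r =ᶠ[nhds s] bentCurve r₁ D φ χ 1 ε := fun s hs =>
    (eventually_le_nhds (show s < ε / 4 by linarith)).mono fun u hu =>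
      roundedCurve_eq_left hε hχ0 hu
  have hright : ∀ s, 0 ≤ s → r =ᶠ[nhds s] bentCurve r₂ D φ χ (-1) ε := fun s hs =>
    (eventually_ge_nhds (show -(ε / 4) < s by linarith)).mono fun u hu =>
      roundedCurve_eq_right hφ (hp₁.trans hp₂.symm) hε hχ0 hu
  have hL := fun s (hs : |s| < a) (h : s ≤ 0) =>
    hspec₁ ε hε (by linarith) s hs (by linarith) r (hleft s h)
  have hR := fun s (hs : |s| < a) (h : 0 ≤ s) =>
    hspec₂ ε hε (by linarith) s hs (by linarith) r (hright s h)
  have eq_left : ∀ s ≤ -ε, r s = r₁ s := fun s hs => by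
    rw [(hleft s (by linarith)).self_of_nhds]
    exact bentCurve_eq_self hφ hχ1 hε (by linarith)
  have eq_right : ∀ s, ε ≤ s → r s = r₂ s := fun s hs => by
    rw [(hright s (by linarith)).self_of_nhds]
    exact bentCurve_eq_self hφ hχ1 hε (by linarith)
  have hnear : ∀ s, |s| ≤ ε → dist (r s) p < d := by
    intro s hs
    rw [dist_eq_norm]
    obtain ⟨hs1, hs2⟩ := abs_le.1 hs
    rcases le_total s 0 with h | h
    · have := (hL s (by linarith) h).2.2.1 (by linarith)
      rw [hp₁] at this
      linarith
    · have := (hR s (by linarith) h).2.2.1 (by linarith)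
      rw [hp₂] at this
      linarith
  have hderiv : ∀ s, |s| < a → DifferentiableAt ℝ r s ∧ 0 < inner ℝ e (deriv r s) := by
    intro s hs
    rcases le_total s 0 with h | h
    · exact ⟨(hL s hs h).1, (hL s hs h).2.1⟩
    · exact ⟨(hR s hs h).1, (hR s hs h).2.1⟩
  have hJmem : ∀ s ∈ J, (s ≤ 0 ∧ s ∈ I₁) ∨ (0 ≤ s ∧ s ∈ I₂) := by
    rintro s (⟨h, h'⟩ | ⟨h, h'⟩)
    · exact Or.inl ⟨h', h⟩
    · exact Or.inr ⟨h', h⟩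
  have hout : ∀ s ∈ J, ε ≤ |s| → (s ≤ -ε ∧ s ∈ I₁) ∨ (ε ≤ s ∧ s ∈ I₂) := by
    intro s hs hεs
    rcases hJmem s hs with ⟨h, h'⟩ | ⟨h, h'⟩
    · rw [abs_of_nonpos h] at hεs
      exact Or.inl ⟨by linarith, h'⟩
    · rw [abs_of_nonneg h] at hεs
      exact Or.inr ⟨hεs, h'⟩
  have hfar : ∀ s ∈ J, a / 2 ≤ |s| → d ≤ dist (r s) p := by
    intro s hs has
    rcases hout s hs (by linarith) with ⟨h, h'⟩ | ⟨h, h'⟩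
    · rw [eq_left s h]
      exact ((min_le_left _ _).trans (min_le_left _ _)).trans (hfar₁ s h' has)
    · rw [eq_right s h]
      exact ((min_le_left _ _).trans (min_le_right _ _)).trans (hfar₂ s h' has)
  have hsmooth : ∀ s ∈ J, ContDiffAt ℝ ∞ r s := by
    intro s hs
    rcases hJmem s hs with ⟨h, h'⟩ | ⟨h, h'⟩
    · exact (contDiffAt_bentCurve hφ hχs (h₁.smooth s h')).congr_of_eventuallyEq (hleft s h)
    · exact (contDiffAt_bentCurve hφ hχs (h₂.smooth s h')).congr_of_eventuallyEq (hright s h)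
  have hmono : StrictMonoOn (fun s => inner ℝ e (r s)) (Set.Ioo (-a) a) := by
    have hd' : ∀ s ∈ Set.Ioo (-a) a,
        HasDerivAt (fun s => inner ℝ e (r s)) (inner ℝ e (deriv r s)) s := fun s hs => by
      simpa using (hasDerivAt_const s e).inner ℝ (hderiv s (abs_lt.2 hs)).1.hasDerivAt
    refine strictMonoOn_of_deriv_pos (convex_Ioo _ _)
      (fun s hs => (hd' s hs).continuousAt.continuousWithinAt) fun s hs => ?_
    rw [interior_Ioo] at hs
    rw [(hd' s hs).deriv]
    exact (hderiv s (abs_lt.2 hs)).2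
  have hcross : ∀ s ∈ I₁, ∀ t ∈ I₂, s ≠ 0 → r₁ s ≠ r₂ t := by
    intro s hs t ht hs0 heq
    have h : r₁ s ∈ r₁ '' I₁ ∩ r₂ '' I₂ := ⟨⟨s, hs, rfl⟩, ⟨t, ht, heq.symm⟩⟩
    rw [hinter, Set.mem_singleton_iff, ← hp₁] at h
    exact hs0 ((Set.injOn_iff_injective.2 h₁.embedding.injective) hs h0₁ h)
  have hinj : Set.InjOn r J := by
    -- Within the window, monotonicity along `e` decides; outside it, `r s` is at distance at least
    -- `d` from `p`, while `r t` is closer.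
    have hin : ∀ s ∈ J, ∀ t ∈ J, |t| < ε → r s = r t → s = t := by
      intro s hs t ht htε hst
      rcases lt_or_ge |s| a with h | h
      · exact hmono.injOn (abs_lt.1 h) (abs_lt.1 (by linarith)) (by simp only [hst])
      · have h1 := hfar s hs (by linarith)
        have h2 := hnear t htε.le
        rw [hst] at h1
        exact absurd h1 (not_le.2 h2)
    intro s hs t ht hst
    rcases lt_or_ge |t| ε with htε | htε
    · exact hin s hs t ht htε hst
    rcases lt_or_ge |s| ε with hsε | hsε
    · exact (hin t ht s hs hsε hst.symm).symm
    rcases hout s hs hsε with ⟨h, hsI⟩ | ⟨h, hsI⟩ <;>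
      rcases hout t ht htε with ⟨h', htI⟩ | ⟨h', htI⟩
    · rw [eq_left s h, eq_left t h'] at hst
      exact (Set.injOn_iff_injective.2 h₁.embedding.injective) hsI htI hst
    · rw [eq_left s h, eq_right t h'] at hst
      exact absurd hst (hcross s hsI t htI (by linarith))
    · rw [eq_right s h, eq_left t h'] at hst
      exact absurd hst.symm (hcross t htI s hsI (by linarith))
    · rw [eq_right s h, eq_right t h'] at hst
      exact (Set.injOn_iff_injective.2 h₂.embedding.injective) hsI htI hst
  refine ⟨ε, hε, hεε₀, r, ?_, ?_, ?_⟩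
  · refine
      { left_mem := hI₁ _ (by linarith) (by linarith)
        right_mem := hI₂ _ (by linarith) (by linarith)
        smooth := hsmooth
        regular := ?_
        halfPlane := ?_
        eq_left := eq_left
        eq_right := eq_right
        near := fun s hs => (hnear s (abs_le.2 hs)).trans_le
          ((min_le_right _ _).trans (min_le_left _ _))
        injective := hinj
        embedding := fun hc => ?_ }
    · intro s hs h0
      rcases lt_or_ge |s| a with h | h
      · have := (hderiv s h).2
        rw [h0, inner_zero_right] at this
        exact lt_irrefl _ this
      · rcases hJmem s hs with ⟨h', hsI⟩ | ⟨h', hsI⟩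
        · rw [abs_of_nonpos h'] at h
          have hev : r =ᶠ[nhds s] r₁ :=
            (eventually_le_nhds (show s < -ε by linarith)).mono fun u hu => eq_left u hu
          have := h₁.arcLength s hsI
          rw [← hev.deriv_eq, h0, norm_zero] at this
          exact zero_ne_one this
        · rw [abs_of_nonneg h'] at h
          have hev : r =ᶠ[nhds s] r₂ :=
            (eventually_ge_nhds (show ε < s by linarith)).mono fun u hu => eq_right u hu
          have := h₂.arcLength s hsI
          rw [← hev.deriv_eq, h0, norm_zero] at this
          exact zero_ne_one this
    · intro s hs
      rcases lt_or_ge |s| ε with h | h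
      · have h1 := hnear s h.le
        rw [dist_eq_norm] at h1
        have h2 := (PiLp.norm_apply_le (r s - p) 1).trans_lt (h1.trans_le
          ((min_le_right _ _).trans (min_le_right _ _)))
        rw [PiLp.sub_apply, Real.norm_eq_abs, abs_lt] at h2
        linarith [h2.1]
      · rcases hout s hs h with ⟨h, h'⟩ | ⟨h, h'⟩
        · rw [eq_left s h]
          exact h₁.halfPlane s h'
        · rw [eq_right s h]
          exact h₂.halfPlane s h'
    · refine isEmbedding_of_eq_outside (a := a / 2)
        (fun s hs => (hsmooth s hs).continuousAt.continuousWithinAt) hinj hc ?_ hεa.le ?_ hfar hnear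
      · intro s hs
        rcases le_total s 0 with h | h
        · exact Or.inl ⟨hI₁ s (by linarith [hs.1]) h, h⟩
        · exact Or.inr ⟨hI₂ s h (by linarith [hs.2]), h⟩
      · intro s hs h
        rcases hout s hs h with ⟨h, -⟩ | ⟨h, -⟩
        · rw [eq_left s h, cornerCurve, if_pos (by linarith)]
        · rw [eq_right s h, cornerCurve, if_neg (by linarith)]
  · intro s hs
    exact (hL s (abs_lt.2 ⟨by linarith [hs.1], by linarith [hs.2]⟩) hs.2.le).2.2.2
      (by linarith [hs.1])
  · intro s hs
    exact (hR s (abs_lt.2 ⟨by linarith [hs.1], by linarith [hs.2]⟩) hs.1.le).2.2.2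
      (by linarith [hs.2])

end RoundCorner

theorem mainTheorem3 (r₁ r₂ : ℝ → RoundCorner.Plane) (I₁ I₂ : Set ℝ) (p : RoundCorner.Plane)
    (h₁ : RoundCorner.IsEmbeddedArcLengthCurve r₁ I₁)
    (h₂ : RoundCorner.IsEmbeddedArcLengthCurve r₂ I₂)
    (h0₁ : (0 : ℝ) ∈ I₁) (hneg : ∃ s ∈ I₁, s < 0)
    (h0₂ : (0 : ℝ) ∈ I₂) (hpos : ∃ s ∈ I₂, 0 < s)
    (hp₁ : r₁ 0 = p) (hp₂ : r₂ 0 = p)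
    (hinter : r₁ '' I₁ ∩ r₂ '' I₂ = {p}) :
    (0 < inner ℝ (RoundCorner.unitTangent r₂ 0) (RoundCorner.unitNormal r₁ 0) →
      ∀ δ > 0, ∀ ε₀ > 0, ∃ ε : ℝ, 0 < ε ∧ ε < ε₀ ∧ ∃ r : ℝ → RoundCorner.Plane,
        RoundCorner.IsRoundCorner r₁ r₂ I₁ I₂ p δ ε r ∧
        (∀ s ∈ Set.Ioo (-ε) 0, RoundCorner.revolutionMeanCurvature r s ≥
          RoundCorner.revolutionMeanCurvature r₁ s) ∧
        (∀ s ∈ Set.Ioo 0 ε, RoundCorner.revolutionMeanCurvature r s ≥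
          RoundCorner.revolutionMeanCurvature r₂ s)) ∧
    (inner ℝ (RoundCorner.unitTangent r₂ 0) (RoundCorner.unitNormal r₁ 0) < 0 →
      ∀ δ > 0, ∀ ε₀ > 0, ∃ ε : ℝ, 0 < ε ∧ ε < ε₀ ∧ ∃ r : ℝ → RoundCorner.Plane,
        RoundCorner.IsRoundCorner r₁ r₂ I₁ I₂ p δ ε r ∧
        (∀ s ∈ Set.Ioo (-ε) 0, RoundCorner.revolutionMeanCurvature r s ≤
          RoundCorner.revolutionMeanCurvature r₁ s) ∧
        (∀ s ∈ Set.Ioo 0 ε, RoundCorner.revolutionMeanCurvature r s ≤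
          RoundCorner.revolutionMeanCurvature r₂ s)) := by
  refine ⟨fun h δ hδ ε₀ hε₀ => ?_, fun h δ hδ ε₀ hε₀ => ?_⟩
  · obtain ⟨ε, hε, hεε₀, r, hr, hl, hr'⟩ := RoundCorner.exists_isRoundCorner (η := 1) h₁ h₂ h0₁ hneg
      h0₂ hpos hp₁ hp₂ hinter (by simp) (by simpa using h) hδ hε₀
    exact ⟨ε, hε, hεε₀, r, hr, fun s hs => by simpa using hl s hs,
      fun s hs => by simpa using hr' s hs⟩
  · obtain ⟨ε, hε, hεε₀, r, hr, hl, hr'⟩ := RoundCorner.exists_isRoundCorner (η := -1) h₁ h₂ h0₁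
      hneg h0₂ hpos hp₁ hp₂ hinter (by simp) (by simpa using h) hδ hε₀
    exact ⟨ε, hε, hεε₀, r, hr, fun s hs => by simpa using hl s hs,
      fun s hs => by simpa using hr' s hs⟩
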